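/- Let $K,D,M,d_e,L,W,S,n\ge 1$ be integers and $B>0$ real. $\mathcal W(L,W,S,B)$ is the set of parameters $\omega=((A^{(l)},b^{(l)}))_{l=1}^L$, with $A^{(l)}\in\mathbb R^{W_l\times W_{l-1}}$, $b^{(l)}\in\mathbb R^{W_l}$, of ReLU networks $f_\omega=(A^{(L)}\mathrm{ReLU}(\cdot)+b^{(L)})\circ\cdots\circ(A^{(1)}x+b^{(1)})$ with $W_0=D$, $W_L=M$, layer widths $W_l\le W$ $(1\le l\le L)$, at most $S$ nonzero entries in total, and all entries bounded by $B$ in absolute value. Let $$\Phi=[0,1]^{d_e},\qquad \Psi=[0,1]^{M\times d_e}\times[-B,B]^{D\times d_e}\times[-B,B]^D\times\mathcal W(L,W,S,B).$$ For $\phi\in\Phi$ and $\psi=(V_X,A_0,b_0,\omega)\in\Psi$ let $p_{\phi,\psi}$ be the autoregressive probability mass function on $[M]^D$ $$p_{\phi,\psi}(x)=\prod_{d=1}^D\mathrm{softmax}\big(f_\omega(v_1(x),\dots,v_d(x),0,\dots,0)\big)[x_d],$$ where $v_1=\sigma(A_0[1,:]\phi+b_0[1])$, $v_i(x)=\sigma(A_0[i,:]V_X[x_{i-1},:]^\top+b_0[i])$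 for $2\le i\le D$, and $\sigma(t)=1/(1+e^{-t})$. Let $p_Y$ be a probability distribution on the source labels $[K]$, let $\phi_1^*,\dots,\phi_K^*\in\Phi$ and $\psi^*\in\Psi$, and let $p^*(x\mid k)=p_{\phi_k^*,\psi^*}(x)$. Let $(x_i,y_i)$, $i=1,\dots,n$, be i.i.d. with joint law $p^*(x\mid y)\,p_Y(y)$. Let $\hat p^{\mathrm{single}}$ be a maximizer of the conditional likelihood $\prod_{i=1}^n p(x_i\mid y_i)$ over the single-source class $$\mathcal P^{\mathrm{single}}=\{p:\ p(x\mid k)=p_{\phi_k,\psi_k}(x),\ \phi_k\in\Phi,\ \psi_k\in\Psi\ (k\in[K])\},$$ in which every source has its own $\psi_k$. Then for every $0<\delta\le 1/2$, with probability at least $1-\delta$, $$\mathbb E_{Y\sim p_Y}\big[\mathrm{TV}(\hat p^{\mathrm{single}}(\cdot\mid Y),p^*(\cdot\mid Y))\big]=\tilde{\mathcal O}\left(\sqrt{\frac{KL\,(S+D+(D+M+1)d_e)}{n}}\right).$$ More precisely, there is a universal constant $C>0$, independent of all the parameters above, such that with probability at least $1-\delta$ (simultaneously for all maximizers $\hat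 p^{\mathrm{single}}$) the left-hand side is at most $$C\sqrt{\frac{KL\,(S+D+(D+M+1)d_e)\,\log\big(n\,D\,d_e\,L\,(B\vee1)(W+1)\big)+\log(1/\delta)}{n}}.$$ -/

import Mathlib

namespace CondARM

/-- Parameters `((A⁽¹⁾, b⁽¹⁾), …, (A⁽ᴸ⁾, b⁽ᴸ⁾))` of a multilayer perceptron. `MLP M L w` is the type
of all parameter lists with exactly `L` affine layers, input dimension `w` and output dimension `M`;
the hidden widths are free. There is no network with `L = 0`. -/
inductive MLP (M : ℕ) : ℕ → ℕ → Type
  /-- the output layer -/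
  | last {w : ℕ} (A : Matrix (Fin M) (Fin w) ℝ) (b : Fin M → ℝ) : MLP M 1 w
  /-- a hidden layer of width `w'`, placed in front of the remaining layers -/
  | layer {L w w' : ℕ} (A : Matrix (Fin w') (Fin w) ℝ) (b : Fin w' → ℝ) (rest : MLP M L w') :
      MLP M (L + 1) w

namespace MLP

variable {M : ℕ}

/-- The function `(A⁽ᴸ⁾ ReLU(·) + b⁽ᴸ⁾) ∘ ⋯ ∘ (A⁽¹⁾ x + b⁽¹⁾)`. -/
noncomputable def eval : {L w : ℕ} → MLP M L w → (Fin w → ℝ) → (Fin M → ℝ)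
  | _, _, last A b, x => A.mulVec x + b
  | _, _, layer A b rest, x => rest.eval (fun i => max 0 ((A.mulVec x + b) i))

/-- All layer widths `W₁, …, W_L` (those of the hidden layers and of the output) are at most `W`. -/
def WidthLE (W : ℕ) : {L w : ℕ} → MLP M L w → Prop
  | _, _, last _ _ => M ≤ W
  | _, _, @layer _ _ _ w' _ _ rest => w' ≤ W ∧ rest.WidthLE W

open Classical in
/-- `∑ₗ (‖A⁽ˡ⁾‖₀ + ‖b⁽ˡ⁾‖₀)`, the number of nonzero entries. -/
noncomputable def nnz : {L w : ℕ} → MLP M L w → ℕ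
  | _, _, last A b =>
      (Finset.univ.filter fun ij : _ × _ => A ij.1 ij.2 ≠ 0).card
        + (Finset.univ.filter fun i => b i ≠ 0).card
  | _, _, layer A b rest =>
      (Finset.univ.filter fun ij : _ × _ => A ij.1 ij.2 ≠ 0).card
        + (Finset.univ.filter fun i => b i ≠ 0).card + rest.nnz

/-- All entries of all `A⁽ˡ⁾`, `b⁽ˡ⁾` are bounded by `B` in absolute value. -/
def EntriesLE (B : ℝ) : {L w : ℕ} → MLP M L w → Prop
  | _, _, last A b => (∀ i j, |A i j| ≤ B) ∧ ∀ i, |b i| ≤ B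
  | _, _, layer A b rest => (∀ i j, |A i j| ≤ B) ∧ (∀ i, |b i| ≤ B) ∧ rest.EntriesLE B

end MLP

/-- The MLP parameter space `𝒲(L, W, S, B)` with input dimension `D` and output dimension `M`. -/
def mlpSpace (D M L W S : ℕ) (B : ℝ) : Set (MLP M L D) :=
  {ω | ω.WidthLE W ∧ ω.nnz ≤ S ∧ ω.EntriesLE B}

/-- The sharable parameters `ψ = (V_X, A₀, b₀, ω)` of the autoregressive model: token embedding
matrix, encoding layer and MLP. -/
structure SharedParam (D M de L : ℕ) where
  VX : Matrix (Fin M) (Fin de) ℝ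
  A₀ : Matrix (Fin D) (Fin de) ℝ
  b₀ : Fin D → ℝ
  ω : MLP M L D

/-- `Φ = [0,1]^{dₑ}`. -/
def PhiSpace (de : ℕ) : Set (Fin de → ℝ) := {φ | ∀ i, φ i ∈ Set.Icc (0 : ℝ) 1}

/-- `Ψ = [0,1]^{M×dₑ} × [-B,B]^{D×dₑ} × [-B,B]^D × 𝒲(L,W,S,B)`. -/
def PsiSpace (D M de L W S : ℕ) (B : ℝ) : Set (SharedParam D M de L) :=
  {ψ | (∀ m i, ψ.VX m i ∈ Set.Icc (0 : ℝ) 1) ∧ (∀ d i, ψ.A₀ d i ∈ Set.Icc (-B) B) ∧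
    (∀ d, ψ.b₀ d ∈ Set.Icc (-B) B) ∧ ψ.ω ∈ mlpSpace D M L W S B}

section Model

variable {D M de L K : ℕ}

/-- The stacked embeddings: row `0` is the source embedding `φ`, row `d ≥ 1` is the embedding of the
token preceding position `d` (positions are counted from `0`; the last token is not used). -/
def embed (φ : Fin de → ℝ) (VX : Matrix (Fin M) (Fin de) ℝ) (x : Fin D → Fin M) :
    Matrix (Fin D) (Fin de) ℝ :=
  fun d => if d.val = 0 then φ else VX (x ⟨d.val - 1, (Nat.sub_le _ _).trans_lt d.isLt⟩)

/-- The encoding `v[d] = σ(A₀[d,:] E[d,:]ᵀ + b₀[d])` with the logistic sigmoid `σ`. -/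
noncomputable def encode (A₀ : Matrix (Fin D) (Fin de) ℝ) (b₀ : Fin D → ℝ)
    (E : Matrix (Fin D) (Fin de) ℝ) : Fin D → ℝ :=
  fun d => Real.sigmoid (A₀ d ⬝ᵥ E d + b₀ d)

/-- Keep the entries up to position `d` and replace the later ones by `0`. -/
def maskAfter (d : Fin D) (v : Fin D → ℝ) : Fin D → ℝ := fun i => if i ≤ d then v i else 0

noncomputable def softmax (h : Fin M → ℝ) : Fin M → ℝ :=
  fun m => Real.exp (h m) / ∑ i, Real.exp (h i)

/-- The distribution parameter `ρ_θ(x_{<d}, y)` of the token at position `d`, where `φ` is the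
embedding of the source `y`. By the masking it depends on `x` only through the tokens before `d`. -/
noncomputable def tokenProb (φ : Fin de → ℝ) (ψ : SharedParam D M de L) (x : Fin D → Fin M)
    (d : Fin D) : Fin M → ℝ :=
  softmax (ψ.ω.eval (maskAfter d (encode ψ.A₀ ψ.b₀ (embed φ ψ.VX x))))

/-- The autoregressive probability mass function `p_{φ,ψ}(x) = ∏_d ρ(x_{<d}, y)[x_d]`. -/
noncomputable def armPmf (φ : Fin de → ℝ) (ψ : SharedParam D M de L) (x : Fin D → Fin M) : ℝ :=
  ∏ d, tokenProb φ ψ x d (x d)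

/-- A conditional mass function `p(x | y)`, written `p y x`, of texts in `[M]^D` given a source
label in `[K]`. -/
abbrev CondPmf (K D M : ℕ) : Type := Fin K → (Fin D → Fin M) → ℝ

/-- The single-source conditional distribution space: every source `k` has its own `φ_k ∈ Φ` and
its own `ψ_k ∈ Ψ`. -/
def singleClass (K D M de L W S : ℕ) (B : ℝ) : Set (CondPmf K D M) :=
  {p | ∃ (φ : Fin K → Fin de → ℝ) (ψ : Fin K → SharedParam D M de L),
    (∀ k, φ k ∈ PhiSpace de) ∧ (∀ k, ψ k ∈ PsiSpace D M de L W S B) ∧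
      p = fun y x => armPmf (φ y) (ψ y) x}

/-- The conditional likelihood `∏ᵢ p(xᵢ | yᵢ)` of a data set of pairs `(xᵢ, yᵢ)`. -/
noncomputable def likelihood {n : ℕ} (s : Fin n → (Fin D → Fin M) × Fin K) (p : CondPmf K D M) : ℝ :=
  ∏ i, p (s i).2 (s i).1

/-- `phat` is a maximizer of the conditional likelihood over the class `P`. -/
def IsCondMLE {n : ℕ} (P : Set (CondPmf K D M)) (s : Fin n → (Fin D → Fin M) × Fin K)
    (phat : CondPmf K D M) : Prop :=
  phat ∈ P ∧ ∀ p ∈ P, likelihood s p ≤ likelihood s phat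

/-- The joint law of `(X, Y)`, with mass `p(x | y) p_Y(y)` at `(x, y)`. -/
noncomputable def jointLaw (p : CondPmf K D M) (pY : Fin K → ℝ) :
    MeasureTheory.Measure ((Fin D → Fin M) × Fin K) :=
  ∑ z : (Fin D → Fin M) × Fin K,
    ENNReal.ofReal (p z.2 z.1 * pY z.2) • MeasureTheory.Measure.dirac z

/-- The average total variation error `E_Y[TV(p(·|Y), q(·|Y))]`. -/
noncomputable def avgTV (pY : Fin K → ℝ) (p q : CondPmf K D M) : ℝ :=
  ∑ y, pY y * ((1 / 2) * ∑ x, |p y x - q y x|)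

end Model

end CondARM

/-! The class has a finite multiplicative net: every member `r` satisfies `r ≤ exp (1 / n) * q` for
a net point `q` that is again in the class. If `r` maximizes the likelihood, then `q` has likelihood
at least `exp (-1)` times that of the truth `p`. For a fixed `q`, the product of `√(q / p)` over the
sample has mean `ρ ^ n ≤ exp (-n * (1 - ρ))`, where `ρ` is the source-averaged Hellinger affinity of
`q` and `p`. Markov's inequality and a union bound over the net `N` therefore force `2 - 2 * ρ` to
be of order `(1 + log |N| + log (1 / δ)) / n` for the `q` attached to any maximizer. This quantity
dominates the squared total variation between `q` and `p`, while `r` and `q` differ by `O(1 / n)`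
(`one_sub_le_measureReal_mle`).

The net comes from rounding all parameters to a grid (`exists_net`). Rounding moves the logits by
the grid step times a factor exponential in `L` (`MLP.abs_eval_sub_le`), so the step must be
exponentially small in `L`, which puts a factor `L` into `log |N|`. Sparsity lets the network
contribute `S` rather than its full number of entries, and choosing a net point for each source
separately gives the factor `K`. -/

namespace CondARM

/-! ### Positivity and normalization of the autoregressive model. -/

section Autoregressive

/-- Masses of an autoregressive factorization sum to one: the conditional distribution of the token
at position `d` may depend only on the tokens before `d`. -/
theorem sum_prod_autoregressive {M : ℕ} [NeZero M] :
    ∀ {D : ℕ} (f : Fin D → (Fin D → Fin M) → Fin M → ℝ),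
      (∀ d x x', (∀ i, i < d → x i = x' i) → f d x = f d x') →
      (∀ d x, ∑ m, f d x m = 1) → ∑ x : Fin D → Fin M, ∏ d, f d x (x d) = 1
  | 0, _, _, _ => by simp
  | D + 1, f, hf, hs => by
    -- With the first token fixed, the remaining factors are again autoregressive in the remaining
    -- tokens.
    have key : ∀ a : Fin M, ∑ y : Fin D → Fin M,
        ∏ d : Fin D, f d.succ (Fin.cons a y : Fin (D + 1) → Fin M) (y d) = 1 := fun a =>
      sum_prod_autoregressive (fun d y => f d.succ (Fin.cons a y : Fin (D + 1) → Fin M))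
        (fun d x x' h => hf _ _ _ fun i hi => by
          cases i using Fin.cases with
          | zero => rfl
          | succ i => simpa using h i (by simpa using hi))
        (fun d x => hs _ _)
    have h0 : ∀ x, f 0 x = f 0 (fun _ => 0) := fun x =>
      hf _ _ _ fun i hi => absurd hi (Fin.not_lt_zero i)
    rw [← (Fin.consEquiv fun _ : Fin (D + 1) => Fin M).sum_comp, Fintype.sum_prod_type]
    simp only [Fin.prod_univ_succ, Fin.consEquiv_apply, Fin.cons_zero, Fin.cons_succ]
    simp only [Fin.consEquiv, Equiv.coe_fn_mk, h0, ← Finset.mul_sum, key, mul_one, hs]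

variable {D M de L : ℕ}

theorem softmax_pos [NeZero M] (h : Fin M → ℝ) (m : Fin M) : 0 < softmax h m :=
  div_pos (Real.exp_pos _) (Finset.sum_pos (fun _ _ => Real.exp_pos _) ⟨m, Finset.mem_univ _⟩)

theorem sum_softmax [NeZero M] (h : Fin M → ℝ) : ∑ m, softmax h m = 1 := by
  have : 0 < ∑ i, Real.exp (h i) :=
    Finset.sum_pos (fun _ _ => Real.exp_pos _) ⟨0, Finset.mem_univ _⟩
  simp only [softmax, ← Finset.sum_div, div_self this.ne']

theorem armPmf_pos [NeZero M] (φ : Fin de → ℝ) (ψ : SharedParam D M de L) (x : Fin D → Fin M) :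
    0 < armPmf φ ψ x :=
  Finset.prod_pos fun _ _ => softmax_pos _ _

theorem sum_armPmf [NeZero M] (φ : Fin de → ℝ) (ψ : SharedParam D M de L) :
    ∑ x, armPmf φ ψ x = 1 := by
  refine sum_prod_autoregressive (fun d x => tokenProb φ ψ x d) ?_ fun d x => sum_softmax _
  intro d x x' h
  simp only [tokenProb]
  congr 2
  funext i
  simp only [maskAfter]
  split_ifs with hi
  · simp only [encode, embed]
    split_ifs with h0
    · rfl
    -- Row `i ≤ d` with `i ≠ 0` reads token `i - 1`, which lies strictly before `d`.
    · rw [h]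
      rw [Fin.le_def] at hi
      rw [Fin.lt_def]
      simp only
      omega
  · rfl

end Autoregressive

/-! ### Stability of the mass function under parameter perturbation. -/

section Perturbation

variable {D M de L : ℕ}

/-- The numerator and the normalizer each cost one factor `exp τ`; the number of classes does not
enter. -/
theorem softmax_le_exp_mul {h h' : Fin M → ℝ} {τ : ℝ} (H : ∀ i, |h i - h' i| ≤ τ) (m : Fin M) :
    softmax h m ≤ Real.exp (2 * τ) * softmax h' m := by
  have pos : ∀ g : Fin M → ℝ, 0 < ∑ i, Real.exp (g i) := fun g =>
    Finset.sum_pos (fun _ _ => Real.exp_pos _) ⟨m, Finset.mem_univ _⟩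
  have h1 : Real.exp (h m) ≤ Real.exp τ * Real.exp (h' m) := by
    rw [← Real.exp_add]
    exact Real.exp_le_exp.2 (by linarith [(abs_le.1 (H m)).2])
  have h2 : ∑ i, Real.exp (h' i) ≤ Real.exp τ * ∑ i, Real.exp (h i) := by
    rw [Finset.mul_sum]
    refine Finset.sum_le_sum fun i _ => ?_
    rw [← Real.exp_add]
    exact Real.exp_le_exp.2 (by linarith [(abs_le.1 (H i)).1])
  unfold softmax
  rw [← mul_div_assoc, div_le_div_iff₀ (pos h) (pos h'), two_mul, Real.exp_add]
  calc Real.exp (h m) * ∑ i, Real.exp (h' i)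
      ≤ (Real.exp τ * Real.exp (h' m)) * (Real.exp τ * ∑ i, Real.exp (h i)) :=
        mul_le_mul h1 h2 (pos h').le (by positivity)
    _ = _ := by ring

theorem abs_sigmoid_sub_le (a b : ℝ) : |Real.sigmoid a - Real.sigmoid b| ≤ |a - b| := by
  have := Convex.norm_image_sub_le_of_norm_deriv_le (f := Real.sigmoid) (C := 1) (s := Set.univ)
    (x := b) (y := a) (fun x _ => differentiable_sigmoid x) (fun x _ => ?_) convex_univ
    (Set.mem_univ _) (Set.mem_univ _)
  · simpa using this
  · have h0 := Real.sigmoid_pos x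
    have h1 := Real.sigmoid_lt_one x
    rw [Real.deriv_sigmoid, Real.norm_eq_abs, abs_le]
    constructor <;> nlinarith

/-- Perturbation of `x ↦ A x + b` in one coordinate. -/
theorem abs_affine_sub_le {w : ℕ} {a a' x x' : Fin w → ℝ} {c c' B Q η ε : ℝ}
    (hQ : ∀ j, |x j| ≤ Q) (hB : ∀ j, |a' j| ≤ B) (ha : ∀ j, |a j - a' j| ≤ η)
    (hc : |c - c'| ≤ η) (hx : ∀ j, |x j - x' j| ≤ ε) :
    |(a ⬝ᵥ x + c) - (a' ⬝ᵥ x' + c')| ≤ w * (η * Q + B * ε) + η := by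
  have e : (a ⬝ᵥ x + c) - (a' ⬝ᵥ x' + c')
      = (∑ j, ((a j - a' j) * x j + a' j * (x j - x' j))) + (c - c') := by
    have : ∀ j, (a j - a' j) * x j + a' j * (x j - x' j) = a j * x j - a' j * x' j :=
      fun j => by ring
    simp only [dotProduct, this, Finset.sum_sub_distrib]
    ring
  rw [e]
  refine (abs_add_le _ _).trans (add_le_add ?_ hc)
  refine (Finset.abs_sum_le_sum_abs _ _).trans ?_
  refine (Finset.sum_le_card_nsmul _ _ (η * Q + B * ε) fun j _ => ?_).trans (by simp [mul_add])
  refine (abs_add_le _ _).trans ?_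
  rw [abs_mul, abs_mul]
  exact add_le_add (mul_le_mul (ha j) (hQ j) (abs_nonneg _) ((abs_nonneg _).trans (ha j)))
    (mul_le_mul (hB j) (hx j) (abs_nonneg _) ((abs_nonneg _).trans (hB j)))

theorem abs_affine_le {w : ℕ} {a x : Fin w → ℝ} {c B Q : ℝ}
    (hQ : ∀ j, |x j| ≤ Q) (hB : ∀ j, |a j| ≤ B) (hc : |c| ≤ B) :
    |a ⬝ᵥ x + c| ≤ w * (B * Q) + B := by
  refine (abs_add_le _ _).trans (add_le_add ?_ hc)
  refine (Finset.abs_sum_le_sum_abs _ _).trans ?_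
  refine (Finset.sum_le_card_nsmul _ _ (B * Q) fun j _ => ?_).trans (by simp)
  rw [abs_mul]
  exact mul_le_mul (hB j) (hQ j) (abs_nonneg _) ((abs_nonneg _).trans (hB j))

namespace MLP

/-- Entry `(i, j)` of the augmented matrix `[b | A]`, extended by zero to `ℕ × ℕ`. -/
noncomputable def affineEntry {a w : ℕ} (A : Matrix (Fin a) (Fin w) ℝ) (b : Fin a → ℝ)
    (i : ℕ) : ℕ → ℝ
  | 0 => if hi : i < a then b ⟨i, hi⟩ else 0
  | j + 1 => if h : i < a ∧ j < w then A ⟨i, h.1⟩ ⟨j, h.2⟩ else 0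

/-- Entry `(i, j)` of the augmented matrix of layer `l`, extended by zero. -/
noncomputable def entry : {L w : ℕ} → MLP M L w → ℕ → ℕ → ℕ → ℝ
  | _, _, last A b, 0, i, j => affineEntry A b i j
  | _, _, last _ _, _ + 1, _, _ => 0
  | _, _, layer A b _, 0, i, j => affineEntry A b i j
  | _, _, layer _ _ rest, l + 1, i, j => rest.entry l i j

/-- Width of the output of the hidden layer `l`; zero for the output layer and beyond. -/
def hiddenWidth : {L w : ℕ} → MLP M L w → ℕ → ℕ
  | _, _, last _ _, _ => 0
  | _, _, @layer _ _ _ w' _ _ _, 0 => w'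
  | _, _, layer _ _ rest, l + 1 => rest.hiddenWidth l

theorem abs_sub_le_of_affineEntry {a w : ℕ} {A A' : Matrix (Fin a) (Fin w) ℝ} {b b' : Fin a → ℝ}
    {η : ℝ} (h : ∀ i j, |affineEntry A b i j - affineEntry A' b' i j| ≤ η) :
    (∀ i j, |A i j - A' i j| ≤ η) ∧ ∀ i, |b i - b' i| ≤ η := by
  refine ⟨fun i j => ?_, fun i => ?_⟩
  · simpa [affineEntry, i.2, j.2] using h i (j + 1)
  · simpa [affineEntry, i.2] using h i 0

/-- The size bound `Q` and the perturbation bound `η * Q` grow by the same factor `2 * V * B`, so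
the induction over depth has to track `Q` alone. -/
theorem abs_layer_sub_le {a w : ℕ} {A A' : Matrix (Fin a) (Fin w) ℝ} {b b' : Fin a → ℝ}
    {x x' : Fin w → ℝ} {B Q η V : ℝ} (hB1 : 1 ≤ B) (hQ1 : 1 ≤ Q) (hη : 0 ≤ η) (hV : (w : ℝ) + 1 ≤ V)
    (hA : ∀ i j, |A i j| ≤ B) (hb : ∀ i, |b i| ≤ B) (hA' : ∀ i j, |A' i j| ≤ B)
    (h : ∀ i j, |affineEntry A b i j - affineEntry A' b' i j| ≤ η)
    (hx : ∀ j, |x j| ≤ Q) (hxx : ∀ j, |x j - x' j| ≤ η * Q) (i : Fin a) :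
    |(A.mulVec x + b) i| ≤ 2 * V * B * Q ∧
      |(A.mulVec x + b) i - (A'.mulVec x' + b') i| ≤ η * (2 * V * B * Q) := by
  obtain ⟨h1, h2⟩ := abs_sub_le_of_affineEntry h
  have hw : (0 : ℝ) ≤ w := Nat.cast_nonneg w
  have hBQ : 1 ≤ B * Q := one_le_mul_of_one_le_of_one_le hB1 hQ1
  have hb' : B ≤ B * Q := le_mul_of_one_le_right (by linarith) hQ1
  have hq' : Q ≤ B * Q := le_mul_of_one_le_left (by linarith) hB1
  have hV' : ((w : ℝ) + 1) * (B * Q) ≤ V * (B * Q) := mul_le_mul_of_nonneg_right hV (by linarith)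
  constructor
  · refine (abs_affine_le hx (hA i) (hb i)).trans ?_
    nlinarith
  · refine (abs_affine_sub_le hx (hA' i) (h1 i) (h2 i) hxx).trans ?_
    have e1 : (w : ℝ) * (η * Q + B * (η * Q)) + η = η * (w * (Q + B * Q) + 1) := by ring
    rw [e1]
    refine mul_le_mul_of_nonneg_left ?_ hη
    have : (w : ℝ) * (Q + B * Q) ≤ w * (2 * (B * Q)) :=
      mul_le_mul_of_nonneg_left (by linarith) hw
    nlinarith

/-- Networks of equal architecture with `η`-close entries have close outputs. -/
theorem abs_eval_sub_le {B η V : ℝ} {W : ℕ} (hB1 : 1 ≤ B) (hη : 0 ≤ η) (hW : (W : ℝ) + 1 ≤ V)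
    {L w : ℕ} (ω : MLP M L w) : ∀ (ω' : MLP M L w) {x x' : Fin w → ℝ} {Q : ℝ},
      (w : ℝ) + 1 ≤ V → ω.WidthLE W → ω.EntriesLE B → ω'.EntriesLE B →
      ω.hiddenWidth = ω'.hiddenWidth → (∀ l i j, |ω.entry l i j - ω'.entry l i j| ≤ η) →
      1 ≤ Q → (∀ j, |x j| ≤ Q) → (∀ j, |x j - x' j| ≤ η * Q) →
      ∀ m, |ω.eval x m - ω'.eval x' m| ≤ η * ((2 * V * B) ^ L * Q) := by
  induction ω with
  | last A b =>
    intro ω' x x' Q hV _ hE hE' _ hen hQ hx hxx m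
    cases ω' with
    | last A' b' =>
      simpa [eval] using (abs_layer_sub_le hB1 hQ hη hV hE.1 hE.2 hE'.1 (fun i j => hen 0 i j) hx hxx m).2
    | layer A' b' rest => cases rest
  | @layer L w w' A b rest ih =>
    intro ω' x x' Q hV hWd hE hE' hwd hen hQ hx hxx m
    cases ω' with
    | last A' b' => cases rest
    | layer A' b' rest' =>
      -- Equal hidden widths identify the types of the two remaining networks.
      obtain rfl := congrFun hwd 0
      have hl := abs_layer_sub_le hB1 hQ hη hV hE.1 hE.2.1 hE'.1 (fun i j => hen 0 i j) hx hxx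
      have hV0 : (0 : ℝ) ≤ w := Nat.cast_nonneg w
      have hG : 1 ≤ 2 * V * B :=
        one_le_mul_of_one_le_of_one_le (by linarith) hB1
      have := ih rest' (Q := 2 * V * B * Q)
        (x := fun i => max 0 ((A.mulVec x + b) i)) (x' := fun i => max 0 ((A'.mulVec x' + b') i))
        (le_trans (by exact_mod_cast Nat.succ_le_succ hWd.1) hW) hWd.2 hE.2.2 hE'.2.2
        (funext fun l => congrFun hwd (l + 1)) (fun l i j => hen (l + 1) i j)
        (one_le_mul_of_one_le_of_one_le hG hQ)
        (fun j => (by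
          rw [abs_of_nonneg (le_max_left _ _)]
          exact max_le (by nlinarith) ((le_abs_self _).trans (hl j).1)))
        (fun j => (by
          -- ReLU is 1-Lipschitz.
          have := abs_max_sub_max_le_abs ((A.mulVec x + b) j) ((A'.mulVec x' + b') j) 0
          rw [max_comm, max_comm _ (0 : ℝ)] at this
          exact this.trans (hl j).2)) m
      refine this.trans (le_of_eq ?_)
      ring

end MLP

/-- Parameters with `η`-close entries and equal network architecture have multiplicatively close
mass functions. -/
theorem armPmf_le_exp_mul {W S : ℕ} {B B₁ η V : ℝ} (hde : 0 < de) (hBB : B ≤ B₁) (hB1 : 1 ≤ B₁)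
    (hη : 0 ≤ η)
    (hW : (W : ℝ) + 1 ≤ V) (hD : (D : ℝ) + 1 ≤ V) {φ φ' : Fin de → ℝ} {ψ ψ' : SharedParam D M de L}
    (hφ : φ ∈ PhiSpace de) (hψ : ψ ∈ PsiSpace D M de L W S B)
    (hψ' : ψ' ∈ PsiSpace D M de L W S B) (dφ : ∀ i, |φ i - φ' i| ≤ η)
    (dV : ∀ m i, |ψ.VX m i - ψ'.VX m i| ≤ η) (dA : ∀ d i, |ψ.A₀ d i - ψ'.A₀ d i| ≤ η)
    (db : ∀ d, |ψ.b₀ d - ψ'.b₀ d| ≤ η) (dw : ψ.ω.hiddenWidth = ψ'.ω.hiddenWidth)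
    (dω : ∀ l i j, |ψ.ω.entry l i j - ψ'.ω.entry l i j| ≤ η) (x : Fin D → Fin M) :
    armPmf φ ψ x ≤ Real.exp (2 * (η * ((2 * V * B₁) ^ L * (3 * de * B₁)))) ^ D * armPmf φ' ψ' x := by
  have hde' : (1 : ℝ) ≤ de := by exact_mod_cast hde
  have hdB : 1 ≤ de * B₁ := one_le_mul_of_one_le_of_one_le hde' hB1
  have hdB' : (de : ℝ) ≤ de * B₁ := le_mul_of_one_le_right (by linarith) hB1
  have entries_mono : ∀ {L w : ℕ} (ω : MLP M L w), ω.EntriesLE B → ω.EntriesLE B₁ := by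
    intro L w ω
    induction ω with
    | last A b => exact fun h => ⟨fun i j => (h.1 i j).trans hBB, fun i => (h.2 i).trans hBB⟩
    | layer A b rest ih =>
      exact fun h => ⟨fun i j => (h.1 i j).trans hBB, fun i => (h.2.1 i).trans hBB, ih h.2.2⟩
  have henc : ∀ d, |encode ψ.A₀ ψ.b₀ (embed φ ψ.VX x) d - encode ψ'.A₀ ψ'.b₀ (embed φ' ψ'.VX x) d|
      ≤ η * (3 * de * B₁) := by
    intro d
    refine (abs_sigmoid_sub_le _ _).trans ((abs_affine_sub_le (Q := 1) (B := B₁) (η := η) (ε := η)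
      ?_ (fun j => (abs_le.2 (hψ'.2.1 d j)).trans hBB) (dA d) (db d) ?_).trans ?_)
    · intro j
      have : embed φ ψ.VX x d j ∈ Set.Icc (0 : ℝ) 1 := by
        unfold embed
        split_ifs
        · exact hφ j
        · exact hψ.1 _ j
      exact abs_le.2 ⟨by linarith [this.1], this.2⟩
    · intro j
      unfold embed
      split_ifs
      · exact dφ j
      · exact dV _ j
    · have e : (de : ℝ) * (η * 1 + B₁ * η) + η = η * (de + de * B₁ + 1) := by ring
      rw [e]
      exact mul_le_mul_of_nonneg_left (by linarith) hη
  have hprob : ∀ d, tokenProb φ ψ x d (x d) ≤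
      Real.exp (2 * (η * ((2 * V * B₁) ^ L * (3 * de * B₁)))) * tokenProb φ' ψ' x d (x d) := by
    intro d
    -- Here `Q = 3 * de * B₁`: it is at least 1, hence bounds the sigmoid values, and `henc` has
    -- exactly the form `η * Q`.
    refine softmax_le_exp_mul (MLP.abs_eval_sub_le hB1 hη hW ψ.ω ψ'.ω hD hψ.2.2.2.1
      (entries_mono _ hψ.2.2.2.2.2) (entries_mono _ hψ'.2.2.2.2.2) dw dω (by linarith) ?_ ?_) _
    · intro j
      unfold maskAfter
      split_ifs
      · rw [encode, abs_of_pos (Real.sigmoid_pos _)]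
        linarith [Real.sigmoid_lt_one (ψ.A₀ j ⬝ᵥ embed φ ψ.VX x j + ψ.b₀ j)]
      · rw [abs_zero]
        linarith
    · intro j
      unfold maskAfter
      split_ifs
      · exact henc j
      · rw [sub_zero, abs_zero]
        exact mul_nonneg hη (by linarith)
  unfold armPmf
  calc ∏ d, tokenProb φ ψ x d (x d) ≤ ∏ d : Fin D,
        (Real.exp (2 * (η * ((2 * V * B₁) ^ L * (3 * de * B₁)))) * tokenProb φ' ψ' x d (x d)) :=
        Finset.prod_le_prod (fun d _ => div_nonneg (Real.exp_nonneg _)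
          (Finset.sum_nonneg fun _ _ => Real.exp_nonneg _)) fun d _ => hprob d
    _ = _ := by rw [Finset.prod_mul_distrib]; simp

end Perturbation

/-! ### Markov's inequality and the union bound. -/

section Probability

open MeasureTheory

/-- The law on a finite type with mass function `P`. -/
theorem integral_finite_law {α : Type*} [Fintype α] [MeasurableSpace α] [MeasurableSingletonClass α]
    {P : α → ℝ} (hP : ∀ z, 0 ≤ P z) (g : α → ℝ) :
    ∫ z, g z ∂(∑ z, ENNReal.ofReal (P z) • Measure.dirac z) = ∑ z, P z * g z := by
  rw [integral_finsetSum_measure fun z _ => Integrable.smul_measure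
    ((integrable_dirac (by simp)) : Integrable g (Measure.dirac z)) ENNReal.ofReal_ne_top]
  refine Finset.sum_congr rfl fun z _ => ?_
  rw [integral_smul_measure, integral_dirac, ENNReal.toReal_ofReal (hP z), smul_eq_mul]

theorem isProbabilityMeasure_finite_law {α : Type*} [Fintype α] [MeasurableSpace α]
    {P : α → ℝ} (hP : ∀ z, 0 ≤ P z) (h1 : ∑ z, P z = 1) :
    IsProbabilityMeasure (∑ z, ENNReal.ofReal (P z) • Measure.dirac z) := by
  refine ⟨?_⟩
  simp only [Measure.finsetSum_apply, Measure.smul_apply, measure_univ, smul_eq_mul, mul_one]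
  rw [← ENNReal.ofReal_sum_of_nonneg fun z _ => hP z, h1, ENNReal.ofReal_one]

/-- Markov's inequality for a product of i.i.d. nonnegative variables, and a union bound. -/
theorem measureReal_exists_prod_ge_le {α ι : Type*} [Fintype α] [MeasurableSpace α]
    [MeasurableSingletonClass α] {P : α → ℝ} (hP : ∀ z, 0 ≤ P z) (h1 : ∑ z, P z = 1) (n : ℕ)
    (N : Finset ι) (g : ι → α → ℝ) (hg : ∀ q z, 0 ≤ g q z) {c : ℝ} (hc : 0 < c)
    (hρ : ∀ q ∈ N, 0 < ∑ z, P z * g q z) :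
    (Measure.pi fun _ : Fin n => ∑ z, ENNReal.ofReal (P z) • Measure.dirac z).real
      {s | ∃ q ∈ N, c * (∑ z, P z * g q z) ^ n ≤ ∏ i, g q (s i)} ≤ N.card / c := by
  have := isProbabilityMeasure_finite_law hP h1
  set μ : Measure (Fin n → α) :=
    Measure.pi fun _ : Fin n => ∑ z, ENNReal.ofReal (P z) • Measure.dirac z with hμ
  have hset : {s : Fin n → α | ∃ q ∈ N, c * (∑ z, P z * g q z) ^ n ≤ ∏ i, g q (s i)}
      = ⋃ q ∈ N, {s | c * (∑ z, P z * g q z) ^ n ≤ ∏ i, g q (s i)} := by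
    ext s
    simp
  rw [hset]
  refine (measureReal_biUnion_finset_le _ _).trans ?_
  refine (Finset.sum_le_card_nsmul _ _ (1 / c) fun q hq => ?_).trans (by simp [div_eq_mul_inv])
  have hM := mul_meas_ge_le_integral_of_nonneg (μ := μ) (f := fun s => ∏ i, g q (s i))
    (Filter.Eventually.of_forall fun s => Finset.prod_nonneg fun i _ => hg q _) Integrable.of_finite
    (c * (∑ z, P z * g q z) ^ n)
  -- By independence the mean of the product is the `n`-th power of the one-sample mean.
  rw [hμ, integral_fintype_prod_eq_pow, integral_finite_law hP, Fintype.card_fin] at hM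
  have hp := pow_pos (hρ q hq) n
  rw [le_div_iff₀ hc]
  refine le_of_mul_le_mul_right ?_ hp
  rw [one_mul]
  calc _ = c * (∑ z, P z * g q z) ^ n * μ.real {s | c * (∑ z, P z * g q z) ^ n ≤ ∏ i, g q (s i)} := by
        ring
    _ ≤ _ := hM

end Probability

/-! ### Total variation against Hellinger affinity and against one-sided domination. -/

section Hellinger

variable {X : Type*} [Fintype X]

/-- Total variation distance is at most the (unnormalized) Hellinger distance. -/
theorem sq_tv_le_hellinger {p q : X → ℝ} (hp : ∀ x, 0 ≤ p x) (hq : ∀ x, 0 ≤ q x)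
    (sp : ∑ x, p x = 1) (sq : ∑ x, q x = 1) :
    ((1 / 2) * ∑ x, |p x - q x|) ^ 2 ≤ 2 - 2 * ∑ x, √(p x * q x) := by
  -- Cauchy–Schwarz is applied to this factorization; the second factor has squared norm at most 4,
  -- which cancels the squared `1 / 2`.
  have e : ∀ x, |p x - q x| = |√(p x) - √(q x)| * (√(p x) + √(q x)) := fun x => by
    rw [← abs_of_nonneg (add_nonneg (Real.sqrt_nonneg (p x)) (Real.sqrt_nonneg (q x))), ← abs_mul]
    congr 1
    nlinarith [Real.sq_sqrt (hp x), Real.sq_sqrt (hq x)]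
  have hm : ∑ x, (√(p x) - √(q x)) ^ 2 = 2 - 2 * ∑ x, √(p x * q x) := by
    have : ∀ x, (√(p x) - √(q x)) ^ 2 = p x + q x - 2 * √(p x * q x) := fun x => by
      rw [Real.sqrt_mul (hp x)]
      nlinarith [Real.sq_sqrt (hp x), Real.sq_sqrt (hq x)]
    simp only [this, Finset.sum_sub_distrib, Finset.sum_add_distrib, sp, sq, ← Finset.mul_sum]
    norm_num
  have ha : ∑ x, (√(p x) + √(q x)) ^ 2 ≤ 4 := by
    have : ∀ x, (√(p x) + √(q x)) ^ 2 ≤ 2 * p x + 2 * q x := fun x => by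
      nlinarith [Real.sq_sqrt (hp x), Real.sq_sqrt (hq x), sq_nonneg (√(p x) - √(q x))]
    refine (Finset.sum_le_sum fun x _ => this x).trans ?_
    simp only [Finset.sum_add_distrib, ← Finset.mul_sum, sp, sq]
    norm_num
  have hcs := Finset.sum_mul_sq_le_sq_mul_sq Finset.univ (fun x => |√(p x) - √(q x)|)
    (fun x => √(p x) + √(q x))
  simp only [sq_abs, ← e, hm] at hcs
  have h0 : 0 ≤ 2 - 2 * ∑ x, √(p x * q x) := hm ▸ Finset.sum_nonneg fun x _ => sq_nonneg _
  nlinarith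

/-- An upper bound on `p` alone suffices: `|p - q|` is twice the positive part of `p - q` minus `p -
q`, the positive part is at most `(c - 1) * q`, and `p - q` sums to zero. -/
theorem tv_le_of_le_mul {p q : X → ℝ} {c : ℝ} (hq : ∀ x, 0 ≤ q x)
    (sp : ∑ x, p x = 1) (sq : ∑ x, q x = 1) (hc : 1 ≤ c) (h : ∀ x, p x ≤ c * q x) :
    (1 / 2) * ∑ x, |p x - q x| ≤ c - 1 := by
  have : ∀ x, |p x - q x| ≤ 2 * (c - 1) * q x - (p x - q x) := fun x => by
    have h1 := h x
    have h2 : 0 ≤ (c - 1) * q x := mul_nonneg (by linarith) (hq x)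
    rw [abs_le]
    constructor <;> nlinarith
  have := Finset.sum_le_sum fun x (_ : x ∈ Finset.univ) => this x
  simp only [Finset.sum_sub_distrib, ← Finset.mul_sum, sp, sq] at this
  linarith

end Hellinger

/-! ### Representatives of codes and counting of sparse integer vectors. -/

section Counting

/-- Finitely many representatives for the fibers of a map with finitely many values. -/
theorem exists_representatives {α γ : Type*} (A : Set α) (c : α → γ) (T : Finset γ)
    (h : ∀ a ∈ A, c a ∈ T) :
    ∃ N : Finset α, N.card ≤ T.card ∧ (∀ a ∈ N, a ∈ A) ∧ ∀ a ∈ A, ∃ b ∈ N, c a = c b := by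
  classical
  -- The transversal is chosen inside `A`, so that net points will belong to the class itself.
  obtain ⟨s, hsA, hbij⟩ := (Set.surjOn_image c A).exists_bijOn_subset
  have hfin : s.Finite := Set.Finite.of_finite_image
    (T.finite_toSet.subset (by rintro _ ⟨a, ha, rfl⟩; exact h a (hsA ha))) hbij.injOn
  refine ⟨hfin.toFinset, ?_, fun a ha => hsA (by simpa using ha), fun a ha => ?_⟩
  · exact Finset.card_le_card_of_injOn c (fun a ha => h a (hsA (by simpa using ha)))
      (fun a ha b hb => hbij.injOn (by simpa using ha) (by simpa using hb))
  · obtain ⟨b, hb, hbc⟩ := hbij.surjOn ⟨a, ha, rfl⟩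
    exact ⟨b, by simpa using hb, hbc.symm⟩

/-- Integer vectors with entries in `[-m, m]` and at most `S` nonzero entries. -/
noncomputable def sparseBox (ι : Type*) [Fintype ι] [DecidableEq ι] (m S : ℕ) : Finset (ι → ℤ) :=
  (Fintype.piFinset fun _ => Finset.Icc (-(m : ℤ)) m).filter
    fun f => (Finset.univ.filter fun i => f i ≠ 0).card ≤ S

/-- A vector with at most `S + 1` nonzero entries arises from one with at most `S` by a single
coordinate update or by none; the `+ 1` counts the latter. -/
theorem card_sparseBox_le (ι : Type*) [Fintype ι] [DecidableEq ι] (m S : ℕ) :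
    (sparseBox ι m S).card ≤ (Fintype.card ι * (2 * m + 1) + 1) ^ S := by
  induction S with
  | zero =>
    rw [pow_zero, Finset.card_le_one]
    have : ∀ f ∈ sparseBox ι m 0, f = 0 := fun f hf => by
      simp only [sparseBox, Finset.mem_filter, Nat.le_zero, Finset.card_eq_zero,
        Finset.filter_eq_empty_iff, Finset.mem_univ, not_not, true_implies] at hf
      exact funext fun i => hf.2 (x := i)
    intro f hf g hg
    rw [this f hf, this g hg]
  | succ S ih =>
    let T : Finset (Option (ι × ℤ)) :=
      Finset.insertNone (Finset.univ ×ˢ Finset.Icc (-(m : ℤ)) m)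
    have hT : T.card = Fintype.card ι * (2 * m + 1) + 1 := by
      simp only [T, Finset.card_insertNone, Finset.card_product, Finset.card_univ, Int.card_Icc]
      congr 2
      omega
    let upd : (ι → ℤ) → Option (ι × ℤ) → ι → ℤ := fun f o =>
      match o with
      | none => f
      | some p => Function.update f p.1 p.2
    have hsub : sparseBox ι m (S + 1) ⊆ Finset.image₂ upd (sparseBox ι m S) T := by
      intro f hf
      simp only [sparseBox, Finset.mem_filter, Fintype.mem_piFinset] at hf
      rw [Finset.mem_image₂]
      by_cases h0 : ∃ i, f i ≠ 0
      · obtain ⟨i, hi⟩ := h0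
        refine ⟨Function.update f i 0, ?_, some (i, f i), ?_, ?_⟩
        · simp only [sparseBox, Finset.mem_filter, Fintype.mem_piFinset]
          refine ⟨fun j => ?_, ?_⟩
          · rcases eq_or_ne j i with rfl | hj
            · simp
            · simpa [hj] using hf.1 j
          · have hss : (Finset.univ.filter fun j => Function.update f i 0 j ≠ 0)
                ⊂ Finset.univ.filter fun j => f j ≠ 0 := by
              refine Finset.ssubset_iff_of_subset (fun j => ?_) |>.2 ⟨i, by simpa using hi, by simp⟩
              rcases eq_or_ne j i with rfl | hj
              · simp
              · simp [hj]
            have := Finset.card_lt_card hss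
            omega
        · simpa [T] using hf.1 i
        · simp [upd]
      · push Not at h0
        refine ⟨f, ?_, none, by simp [T], rfl⟩
        simp [sparseBox, h0]
    refine (Finset.card_le_card hsub).trans ((Finset.card_image₂_le _ _ _).trans ?_)
    rw [hT, pow_succ]
    exact Nat.mul_le_mul_right _ ih

end Counting

/-! ### Size and support of network entries in architecture-independent coordinates. -/

namespace MLP

variable {M : ℕ}

theorem abs_affineEntry_le {a w : ℕ} {A : Matrix (Fin a) (Fin w) ℝ} {b : Fin a → ℝ} {B : ℝ}
    (hB : 0 ≤ B) (hA : ∀ i j, |A i j| ≤ B) (hb : ∀ i, |b i| ≤ B) (i j : ℕ) :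
    |affineEntry A b i j| ≤ B := by
  cases j <;> simp only [affineEntry] <;> split_ifs <;> simp [hA, hb, hB]

theorem lt_of_affineEntry_ne_zero {a w i j : ℕ} {A : Matrix (Fin a) (Fin w) ℝ} {b : Fin a → ℝ}
    (h : affineEntry A b i j ≠ 0) : i < a ∧ j < w + 1 := by
  cases j <;> simp only [affineEntry] at h <;> split_ifs at h with h' <;>
    first | exact absurd rfl h | omega

theorem exists_support_affineEntry {a w : ℕ} (A : Matrix (Fin a) (Fin w) ℝ) (b : Fin a → ℝ)
    [DecidablePred fun ij : Fin a × Fin w => A ij.1 ij.2 ≠ 0] [DecidablePred fun i => b i ≠ 0] :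
    ∃ s : Finset (ℕ × ℕ), s.card ≤ (Finset.univ.filter fun ij : _ × _ => A ij.1 ij.2 ≠ 0).card
        + (Finset.univ.filter fun i => b i ≠ 0).card ∧
      ∀ i j, affineEntry A b i j ≠ 0 → (i, j) ∈ s := by
  refine ⟨((Finset.univ.filter fun ij : _ × _ => A ij.1 ij.2 ≠ 0).image
      fun ij => (ij.1.val, ij.2.val + 1)) ∪
    ((Finset.univ.filter fun i => b i ≠ 0).image fun i => (i.val, 0)),
    (Finset.card_union_le _ _).trans (add_le_add Finset.card_image_le Finset.card_image_le), ?_⟩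
  intro i j h
  rw [Finset.mem_union, Finset.mem_image, Finset.mem_image]
  cases j with
  | zero =>
    simp only [affineEntry] at h
    split_ifs at h with hi
    · exact Or.inr ⟨⟨i, hi⟩, by simpa using h, rfl⟩
    · exact absurd rfl h
  | succ j =>
    simp only [affineEntry] at h
    split_ifs at h with hi
    · exact Or.inl ⟨(⟨i, hi.1⟩, ⟨j, hi.2⟩), by simpa using h, rfl⟩
    · exact absurd rfl h

theorem abs_entry_le {B : ℝ} (hB : 0 ≤ B) {L w : ℕ} (ω : MLP M L w) (h : ω.EntriesLE B) :
    ∀ l i j, |ω.entry l i j| ≤ B := by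
  induction ω with
  | last A b =>
    intro l i j
    cases l with
    | zero => exact abs_affineEntry_le hB h.1 h.2 i j
    | succ l => simpa [entry] using hB
  | layer A b rest ih =>
    intro l i j
    cases l with
    | zero => exact abs_affineEntry_le hB h.1 h.2.1 i j
    | succ l => exact ih h.2.2 l i j

/-- The row bound covers the output layer because `WidthLE` includes `M ≤ W`. Column `0` holds the
bias, so input width `w` occupies the columns up to `w` inclusive. -/
theorem lt_of_entry_ne_zero {W V L w : ℕ} (ω : MLP M L w) (h : ω.WidthLE W) (hW : W < V)
    (hw : w < V) : ∀ l i j, ω.entry l i j ≠ 0 → l < L ∧ i < W ∧ j < V := by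
  induction ω with
  | last A b =>
    intro l i j
    cases l with
    | zero =>
      intro h0
      have := lt_of_affineEntry_ne_zero h0
      exact ⟨Nat.one_pos, this.1.trans_le h, by omega⟩
    | succ l => exact fun h0 => absurd rfl h0
  | layer A b rest ih =>
    intro l i j
    cases l with
    | zero =>
      intro h0
      have := lt_of_affineEntry_ne_zero h0
      exact ⟨Nat.succ_pos _, this.1.trans_le h.1, by omega⟩
    | succ l =>
      intro h0
      have := ih h.2 (h.1.trans_lt hW) l i j h0
      exact ⟨by omega, this.2⟩

/-- Moves the sparsity constraint to an index set common to all architectures, where networks of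
different widths are counted together. -/
theorem exists_support_entry {L w : ℕ} (ω : MLP M L w) :
    ∃ s : Finset (ℕ × ℕ × ℕ), s.card ≤ ω.nnz ∧ ∀ l i j, ω.entry l i j ≠ 0 → (l, i, j) ∈ s := by
  classical
  induction ω with
  | last A b =>
    obtain ⟨s, hs, h⟩ := exists_support_affineEntry A b
    refine ⟨s.image fun p => (0, p), Finset.card_image_le.trans (by simp only [nnz]; convert hs using 1), ?_⟩
    intro l i j h0
    cases l with
    | zero => exact Finset.mem_image_of_mem _ (h i j h0)
    | succ l => exact absurd rfl h0
  | layer A b rest ih =>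
    obtain ⟨s, hs, h⟩ := exists_support_affineEntry A b
    obtain ⟨t, ht, h'⟩ := ih
    refine ⟨(s.image fun p => (0, p)) ∪ t.image fun p => (p.1 + 1, p.2),
      (Finset.card_union_le _ _).trans (add_le_add (Finset.card_image_le.trans (by convert hs))
        (Finset.card_image_le.trans ht)), ?_⟩
    intro l i j h0
    rw [Finset.mem_union]
    cases l with
    | zero => exact Or.inl (Finset.mem_image_of_mem _ (h i j h0))
    | succ l => exact Or.inr (Finset.mem_image.2 ⟨(l, i, j), h' l i j h0, rfl⟩)

theorem hiddenWidth_le {W L w : ℕ} (ω : MLP M L w) (h : ω.WidthLE W) :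
    ∀ l, ω.hiddenWidth l ≤ W := by
  induction ω with
  | last A b => exact fun l => Nat.zero_le _
  | layer A b rest ih =>
    intro l
    cases l with
    | zero => exact h.1
    | succ l => exact ih h.2 l

theorem hiddenWidth_eq_zero {L w : ℕ} (ω : MLP M L w) : ∀ l, L ≤ l → ω.hiddenWidth l = 0 := by
  induction ω with
  | last A b => exact fun l _ => rfl
  | layer A b rest ih =>
    intro l hl
    cases l with
    | zero => omega
    | succ l => exact ih l (by omega)

end MLP

/-! ### The net obtained by rounding parameters. -/

section Net

variable {D M de L : ℕ}

theorem floor_div_mem_Icc {a B η : ℝ} {m : ℕ} (hη : 0 < η) (hm : B ≤ m * η) (ha : |a| ≤ B) :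
    ⌊a / η⌋ ∈ Finset.Icc (-(m : ℤ)) m := by
  rw [abs_le] at ha
  rw [Finset.mem_Icc, Int.le_floor]
  refine ⟨?_, ?_⟩
  · push_cast
    rw [le_div_iff₀ hη]
    linarith
  · have h1 : (⌊a / η⌋ : ℝ) ≤ (m : ℤ) := (Int.floor_le _).trans (by
      push_cast
      rw [div_le_iff₀ hη]
      linarith)
    exact_mod_cast h1

theorem abs_sub_le_of_floor_div_eq {a b η : ℝ} (hη : 0 < η) (h : ⌊a / η⌋ = ⌊b / η⌋) :
    |a - b| ≤ η := by
  have := Int.abs_sub_lt_one_of_floor_eq_floor h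
  rw [← sub_div, abs_div, abs_of_pos hη, div_lt_one hη] at this
  exact this.le

/-- A finite multiplicative net of the class of autoregressive mass functions. -/
theorem exists_net {W S m : ℕ} {B B₁ η : ℝ} (hde : 0 < de) (hB : 0 ≤ B) (hBB : B ≤ B₁)
    (hB1 : 1 ≤ B₁) (hη : 0 < η) (hm : B₁ ≤ m * η) :
    ∃ N : Finset ((Fin D → Fin M) → ℝ),
      N.card ≤ (2 * m + 1) ^ (D + (D + M + 1) * de) * (W + 1) ^ L
        * (L * (W * (W + D + 1)) * (2 * m + 1) + 1) ^ S ∧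
      (∀ q ∈ N, ∃ φ ∈ PhiSpace de, ∃ ψ ∈ PsiSpace D M de L W S B, q = armPmf φ ψ) ∧
      ∀ φ ∈ PhiSpace de, ∀ ψ ∈ PsiSpace D M de L W S B, ∃ q ∈ N, ∀ x, armPmf φ ψ x ≤
        Real.exp (2 * (η * ((2 * (W + D + 1) * B₁) ^ L * (3 * de * B₁)))) ^ D * q x := by
  classical
  let I : Finset ℤ := Finset.Icc (-(m : ℤ)) m
  have hI : I.card = 2 * m + 1 := by
    simp only [I, Int.card_Icc]
    omega
  let T := (Fintype.piFinset fun _ : Fin de => I) ×ˢ (Fintype.piFinset fun _ : Fin M × Fin de => I)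
    ×ˢ (Fintype.piFinset fun _ : Fin D × Fin de => I) ×ˢ (Fintype.piFinset fun _ : Fin D => I)
    ×ˢ (Fintype.piFinset fun _ : Fin L => Finset.range (W + 1))
    ×ˢ sparseBox (Fin L × Fin W × Fin (W + D + 1)) m S
  -- The code records the hidden widths besides the rounded entries, since the perturbation bound
  -- compares only networks of equal architecture. The column range `W + D + 1` accommodates the
  -- bias and an input of width `D` or at most `W`.
  let c := fun θ : (Fin de → ℝ) × SharedParam D M de L =>
    ((fun i => ⌊θ.1 i / η⌋ : Fin de → ℤ), (fun p => ⌊θ.2.VX p.1 p.2 / η⌋ : Fin M × Fin de → ℤ),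
      (fun p => ⌊θ.2.A₀ p.1 p.2 / η⌋ : Fin D × Fin de → ℤ), (fun d => ⌊θ.2.b₀ d / η⌋ : Fin D → ℤ),
      (fun l => θ.2.ω.hiddenWidth l : Fin L → ℕ),
      (fun p => ⌊θ.2.ω.entry p.1 p.2.1 p.2.2 / η⌋ : Fin L × Fin W × Fin (W + D + 1) → ℤ))
  have hunit : ∀ {a : ℝ}, a ∈ Set.Icc (0 : ℝ) 1 → ⌊a / η⌋ ∈ I := fun ha =>
    floor_div_mem_Icc hη hm ((abs_le.2 ⟨by linarith [ha.1], ha.2⟩).trans hB1)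
  have hbox : ∀ {a : ℝ}, |a| ≤ B → ⌊a / η⌋ ∈ I := fun ha =>
    floor_div_mem_Icc hη hm (ha.trans hBB)
  obtain ⟨N, hcard, hmem, hN⟩ := exists_representatives
    (PhiSpace de ×ˢ PsiSpace D M de L W S B) c T (by
      rintro ⟨φ, ψ⟩ ⟨hφ, hVX, hA, hb, hW, hS, hE⟩
      simp only [T, c, Finset.mem_product, Fintype.mem_piFinset]
      refine ⟨fun i => hunit (hφ i), fun p => hunit (hVX _ _), fun p => hbox (abs_le.2 (hA _ _)),
        fun d => hbox (abs_le.2 (hb d)), fun l => ?_, ?_⟩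
      · exact Finset.mem_range_succ_iff.2 (ψ.ω.hiddenWidth_le hW l)
      · simp only [sparseBox, Finset.mem_filter, Fintype.mem_piFinset]
        refine ⟨fun p => hbox (ψ.ω.abs_entry_le hB hE _ _ _), ?_⟩
        obtain ⟨s, hs, h⟩ := ψ.ω.exists_support_entry
        refine (Finset.card_le_card_of_injOn
          (fun p : Fin L × Fin W × Fin (W + D + 1) => (p.1.val, p.2.1.val, p.2.2.val)) ?_ ?_).trans
          (hs.trans hS)
        · intro p hp
          -- Since `⌊0 / η⌋ = 0`, rounding creates no new nonzero entries.
          refine h _ _ _ fun h0 => ?_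
          rw [Finset.mem_coe, Finset.mem_filter] at hp
          exact hp.2 (by rw [h0]; simp)
        · rintro ⟨l, i, j⟩ _ ⟨l', i', j'⟩ _ h
          simpa [Fin.ext_iff] using h)
  refine ⟨N.image fun θ => armPmf θ.1 θ.2, ?_, ?_, ?_⟩
  · refine Finset.card_image_le.trans (hcard.trans ?_)
    simp only [T, Finset.card_product, Fintype.card_piFinset, Finset.prod_const, Finset.card_univ, hI,
      Fintype.card_prod, Fintype.card_fin, Finset.card_range]
    have := card_sparseBox_le (Fin L × Fin W × Fin (W + D + 1)) m S
    simp only [Fintype.card_prod, Fintype.card_fin] at this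
    refine le_trans (le_of_eq ?_) (Nat.mul_le_mul_left _ this)
    ring
  · intro q hq
    obtain ⟨θ, hθ, rfl⟩ := Finset.mem_image.1 hq
    exact ⟨θ.1, (hmem θ hθ).1, θ.2, (hmem θ hθ).2, rfl⟩
  · intro φ hφ ψ hψ
    obtain ⟨⟨φ', ψ'⟩, hθ, hc⟩ := hN (φ, ψ) ⟨hφ, hψ⟩
    refine ⟨_, Finset.mem_image_of_mem _ hθ, fun x => ?_⟩
    have hψ' := (hmem _ hθ).2
    simp only [c, Prod.mk.injEq] at hc
    obtain ⟨c1, c2, c3, c4, c5, c6⟩ := hc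
    refine armPmf_le_exp_mul hde hBB hB1 hη.le (by linarith [Nat.cast_nonneg (α := ℝ) D])
      (by linarith [Nat.cast_nonneg (α := ℝ) W]) hφ hψ hψ'
      (fun i => abs_sub_le_of_floor_div_eq hη (congrFun c1 i))
      (fun m i => abs_sub_le_of_floor_div_eq hη (congrFun c2 (m, i)))
      (fun d i => abs_sub_le_of_floor_div_eq hη (congrFun c3 (d, i)))
      (fun d => abs_sub_le_of_floor_div_eq hη (congrFun c4 d)) ?_ ?_ x
    · funext l
      by_cases hl : l < L
      · exact congrFun c5 ⟨l, hl⟩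
      · rw [MLP.hiddenWidth_eq_zero _ _ (not_lt.1 hl), MLP.hiddenWidth_eq_zero _ _ (not_lt.1 hl)]
    · intro l i j
      by_cases h : l < L ∧ i < W ∧ j < W + D + 1
      · exact abs_sub_le_of_floor_div_eq hη (congrFun c6 (⟨l, h.1⟩, ⟨i, h.2.1⟩, ⟨j, h.2.2⟩))
      -- Outside the coded box both networks have entry zero.
      · have z : ∀ {ψ : SharedParam D M de L}, ψ ∈ PsiSpace D M de L W S B →
            ψ.ω.entry l i j = 0 := fun {ψ} hψ => by
          by_contra h0
          exact h (ψ.ω.lt_of_entry_ne_zero hψ.2.2.2.1 (by omega) (by omega) l i j h0)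
        rw [z hψ, z hψ', sub_zero, abs_zero]
        exact hη.le

end Net

/-! ### Choice of the resolution. -/

section Rate

/-- The net at resolution `Λ ^ (-9 L)`: its logarithmic size is `O(L (S + D + (D + M + 1) dₑ) log Λ)`
and it loses a factor of at most `exp (1 / n)`. -/
theorem exists_net_at_rate {D M de L W S n : ℕ} {B : ℝ} (hD : 0 < D) (hde : 0 < de)
    (hL : 0 < L) (hW : 0 < W) (hS : 0 < S) (hB : 0 < B) (hn : 0 < n) :
    ∃ N : Finset ((Fin D → Fin M) → ℝ),
      (N.card : ℝ) ≤ ((n : ℝ) * D * de * L * max B 1 * (W + 1))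
        ^ (17 * (L * (S + (D + (D + M + 1) * de)))) ∧
      (∀ q ∈ N, ∃ φ ∈ PhiSpace de, ∃ ψ ∈ PsiSpace D M de L W S B, q = armPmf φ ψ) ∧
      ∀ φ ∈ PhiSpace de, ∀ ψ ∈ PsiSpace D M de L W S B, ∃ q ∈ N, ∀ x, armPmf φ ψ x ≤
        Real.exp (1 / n) * q x := by
  set B₁ := max B 1 with hB₁
  have hB1 : 1 ≤ B₁ := le_max_right _ _
  have hD' : (1 : ℝ) ≤ D := by exact_mod_cast hD
  have hde' : (1 : ℝ) ≤ de := by exact_mod_cast hde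
  have hL' : (1 : ℝ) ≤ L := by exact_mod_cast hL
  have hW' : (1 : ℝ) ≤ W := by exact_mod_cast hW
  have hn' : (1 : ℝ) ≤ n := by exact_mod_cast hn
  set Λ : ℝ := (n : ℝ) * D * de * L * B₁ * (W + 1) with hΛ
  -- every product of distinct factors is at most `Λ`
  have sub : ∀ e₁ e₂ e₃ e₄ e₅ e₆ : ℝ, 0 ≤ e₁ → 0 ≤ e₂ → 0 ≤ e₃ → 0 ≤ e₄ → 0 ≤ e₅ → 0 ≤ e₆ →
      e₁ ≤ n → e₂ ≤ D → e₃ ≤ de → e₄ ≤ L → e₅ ≤ B₁ → e₆ ≤ W + 1 →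
      e₁ * e₂ * e₃ * e₄ * e₅ * e₆ ≤ Λ := by
    intros
    rw [hΛ]
    gcongr
  have hΛ2 : 2 ≤ Λ := by
    have := sub 1 1 1 1 1 2 (by simp) (by simp) (by simp) (by simp) (by simp) (by simp)
      hn' hD' hde' hL' hB1 (by linarith)
    linarith
  have hnD : n * D ≤ Λ := by
    have := sub n D 1 1 1 1 (by linarith) (by linarith) (by simp) (by simp) (by simp) (by simp)
      le_rfl le_rfl hde' hL' hB1 (by linarith)
    linarith
  have hDΛ : D ≤ Λ := (le_mul_of_one_le_left (by linarith) hn').trans hnD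
  have hdB : de * B₁ ≤ Λ := by
    have := sub 1 1 de 1 B₁ 1 (by simp) (by simp) (by linarith) (by simp) (by linarith) (by simp)
      hn' hD' le_rfl hL' le_rfl (by linarith)
    linarith
  have hBΛ : B₁ ≤ Λ := (le_mul_of_one_le_left (by linarith) hde').trans hdB
  have hLW : L * (W + 1) ≤ Λ := by
    have := sub 1 1 1 L 1 (W + 1) (by simp) (by simp) (by simp) (by linarith) (by simp)
      (by linarith) hn' hD' hde' le_rfl hB1 le_rfl
    linarith
  have hWΛ : (W : ℝ) + 1 ≤ Λ := (le_mul_of_one_le_left (by linarith) hL').trans hLW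
  have h1Λ : 1 ≤ Λ := by linarith
  have h0Λ : 0 < Λ := by linarith
  have two_mul_pow : ∀ k, 2 * Λ ^ k ≤ Λ ^ (k + 1) := fun k => by
    rw [pow_succ']
    exact mul_le_mul_of_nonneg_right hΛ2 (by positivity)
  -- The loss exponent, multiplied by `n`, is at most `Λ ^ 2 * (Λ ^ 4) ^ L * Λ ^ 3 * η`, and `4 * L
  -- + 5 ≤ 9 * L` as `L ≥ 1`.
  set η : ℝ := (Λ ^ (9 * L))⁻¹ with hη
  have hη0 : 0 < η := by positivity
  set m : ℕ := ⌈B₁ * Λ ^ (9 * L)⌉₊ with hm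
  have hmη : B₁ ≤ m * η := by
    rw [hη, ← div_eq_mul_inv, le_div_iff₀ (by positivity)]
    exact Nat.le_ceil _
  have hm2 : (2 * m + 1 : ℝ) ≤ Λ ^ (12 * L) := by
    have h1 : (m : ℝ) ≤ B₁ * Λ ^ (9 * L) + 1 := (Nat.ceil_lt_add_one (by positivity)).le
    have h2 : B₁ * Λ ^ (9 * L) ≤ Λ ^ (9 * L + 1) := by
      rw [pow_succ']
      exact mul_le_mul_of_nonneg_right hBΛ (by positivity)
    have h3 := two_mul_pow (9 * L + 1)
    have h4 := two_mul_pow (9 * L + 2)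
    have h5 : (4 : ℝ) ≤ Λ ^ (9 * L + 2) := by
      calc (4 : ℝ) ≤ Λ ^ 2 := by nlinarith
        _ ≤ _ := pow_le_pow_right₀ h1Λ (by omega)
    calc (2 * m + 1 : ℝ) ≤ Λ ^ (9 * L + 3) := by linarith
      _ ≤ _ := pow_le_pow_right₀ h1Λ (by omega)
  obtain ⟨N, hcard, hmem, hN⟩ := exists_net (D := D) (M := M) (L := L) (W := W) (S := S) hde hB.le
    (le_max_left B 1) hB1 hη0 hmη
  refine ⟨N, ?_, hmem, fun φ hφ ψ hψ => ?_⟩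
  · set P := D + (D + M + 1) * de
    have h1 : (L * (W * (W + D + 1)) * (2 * m + 1) + 1 : ℝ) ≤ Λ ^ (16 * L) := by
      have a1 : (L * W : ℝ) ≤ Λ := le_trans (by nlinarith) hLW
      have a2 : (W + D + 1 : ℝ) ≤ 2 * Λ := by linarith
      have a3 : (L * W : ℝ) * (W + D + 1) * (2 * m + 1) ≤ Λ * (2 * Λ) * Λ ^ (12 * L) := by gcongr
      have a4 := two_mul_pow (12 * L + 2)
      have a5 := two_mul_pow (12 * L + 3)
      have a6 : (1 : ℝ) ≤ Λ ^ (12 * L + 3) := one_le_pow₀ h1Λ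
      calc (L * (W * (W + D + 1)) * (2 * m + 1) + 1 : ℝ)
          = (L * W : ℝ) * (W + D + 1) * (2 * m + 1) + 1 := by ring
        _ ≤ Λ * (2 * Λ) * Λ ^ (12 * L) + 1 := by linarith
        _ = 2 * Λ ^ (12 * L + 2) + 1 := by ring
        _ ≤ Λ ^ (12 * L + 4) := by linarith
        _ ≤ _ := pow_le_pow_right₀ h1Λ (by omega)
    calc (N.card : ℝ) ≤ (2 * m + 1) ^ P * (W + 1) ^ L
          * (L * (W * (W + D + 1)) * (2 * m + 1) + 1) ^ S := by exact_mod_cast hcard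
      _ ≤ (Λ ^ (12 * L)) ^ P * Λ ^ L * (Λ ^ (16 * L)) ^ S := by gcongr
      _ = Λ ^ (12 * L * P + L + 16 * L * S) := by rw [← pow_mul, ← pow_mul, ← pow_add, ← pow_add]
      -- The width count `L` is absorbed through `L ≤ L * S`, turning 16 into 17.
      _ ≤ _ := pow_le_pow_right₀ h1Λ (by nlinarith [Nat.mul_le_mul_left L hS, Nat.zero_le (L * P)])
  · obtain ⟨q, hq, h⟩ := hN φ hφ ψ hψ
    refine ⟨q, hq, fun x => (h x).trans ?_⟩
    have hq0 : 0 ≤ q x := by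
      obtain ⟨φ', _, ψ', _, rfl⟩ := hmem q hq
      exact Finset.prod_nonneg fun d _ => div_nonneg (Real.exp_nonneg _)
        (Finset.sum_nonneg fun _ _ => Real.exp_nonneg _)
    refine mul_le_mul_of_nonneg_right ?_ hq0
    rw [← Real.exp_nat_mul]
    refine Real.exp_le_exp.2 ?_
    have c1 : 2 * Λ ≤ Λ ^ 2 := by nlinarith
    have c2 : 2 * Λ ^ 2 ≤ Λ ^ 3 := two_mul_pow 2
    have c3 : 2 * Λ ^ 3 ≤ Λ ^ 4 := two_mul_pow 3
    have b1 : (2 * (W + D + 1) * B₁ : ℝ) ≤ Λ ^ 4 := by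
      calc (2 * (W + D + 1) * B₁ : ℝ) ≤ 2 * (2 * Λ) * Λ := by gcongr; linarith
        _ = 2 * (2 * Λ ^ 2) := by ring
        _ ≤ Λ ^ 4 := by linarith [pow_pos h0Λ 3]
    have b2 : (3 * de * B₁ : ℝ) ≤ Λ ^ 3 := by
      linarith
    have b3 : 2 * (n * D : ℝ) ≤ Λ ^ 2 := by
      linarith
    rw [le_div_iff₀ (by linarith)]
    calc (D : ℝ) * (2 * (η * ((2 * (W + D + 1) * B₁) ^ L * (3 * de * B₁)))) * n
        = 2 * (n * D) * ((2 * (W + D + 1) * B₁) ^ L * (3 * de * B₁)) * η := by ring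
      _ ≤ Λ ^ 2 * ((Λ ^ 4) ^ L * Λ ^ 3) * η := by gcongr
      _ = Λ ^ (4 * L + 5) * η := by rw [← pow_mul, ← pow_add, ← pow_add]; ring_nf
      _ ≤ Λ ^ (9 * L) * η := by
        refine mul_le_mul_of_nonneg_right (pow_le_pow_right₀ h1Λ (by omega)) hη0.le
      _ = 1 := mul_inv_cancel₀ (by positivity)

end Rate

/-! ### Maximum likelihood over a class with a multiplicative net. -/

section Estimation

variable {K D M de L W S n : ℕ}

/-- Cauchy–Schwarz with weights `pY` moves the square inside the average over sources, where the
unconditional bound applies. -/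
theorem avgTV_sq_le_hellinger {pY : Fin K → ℝ} (hY : ∀ y, 0 ≤ pY y) (hY1 : ∑ y, pY y = 1)
    {p q : CondPmf K D M} (hp : ∀ y x, 0 ≤ p y x) (hq : ∀ y x, 0 ≤ q y x)
    (sp : ∀ y, ∑ x, p y x = 1) (sq : ∀ y, ∑ x, q y x = 1) :
    avgTV pY p q ^ 2 ≤ 2 - 2 * ∑ y, pY y * ∑ x, √(p y x * q y x) := by
  have h := Finset.sum_sq_le_sum_mul_sum_of_sq_le_mul Finset.univ
    (r := fun y => pY y * ((1 / 2) * ∑ x, |p y x - q y x|)) (f := pY)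
    (g := fun y => pY y * ((1 / 2) * ∑ x, |p y x - q y x|) ^ 2) (fun y _ => hY y)
    (fun y _ => mul_nonneg (hY y) (sq_nonneg _)) (fun y _ => le_of_eq (by ring))
  rw [hY1, one_mul] at h
  refine h.trans ((Finset.sum_le_sum fun y _ => mul_le_mul_of_nonneg_left
    (sq_tv_le_hellinger (hp y) (hq y) (sp y) (sq y)) (hY y)).trans (le_of_eq ?_))
  simp only [mul_sub, Finset.sum_sub_distrib, ← Finset.sum_mul, hY1, Finset.mul_sum]
  rw [one_mul]
  congr 1
  exact Finset.sum_congr rfl fun y _ => Finset.sum_congr rfl fun x _ => by ring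

theorem avgTV_triangle {pY : Fin K → ℝ} (hY : ∀ y, 0 ≤ pY y) (p q r : CondPmf K D M) :
    avgTV pY p r ≤ avgTV pY p q + avgTV pY q r := by
  unfold avgTV
  rw [← Finset.sum_add_distrib]
  refine Finset.sum_le_sum fun y _ => ?_
  rw [← mul_add, ← mul_add, ← Finset.sum_add_distrib]
  refine mul_le_mul_of_nonneg_left (mul_le_mul_of_nonneg_left
    (Finset.sum_le_sum fun x _ => abs_sub_le _ _ _) (by norm_num)) (hY y)

theorem avgTV_le_of_le_mul {pY : Fin K → ℝ} (hY : ∀ y, 0 ≤ pY y) (hY1 : ∑ y, pY y = 1)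
    {p q : CondPmf K D M} {c : ℝ} (hc : 1 ≤ c) (hq : ∀ y x, 0 ≤ q y x)
    (sp : ∀ y, ∑ x, p y x = 1) (sq : ∀ y, ∑ x, q y x = 1) (h : ∀ y x, p y x ≤ c * q y x) :
    avgTV pY p q ≤ c - 1 := by
  refine (Finset.sum_le_sum fun y _ => mul_le_mul_of_nonneg_left
    (tv_le_of_le_mul (hq y) (sp y) (sq y) hc (h y)) (hY y)).trans (le_of_eq ?_)
  rw [← Finset.sum_mul, hY1, one_mul]

open MeasureTheory in
/-- Maximum likelihood over a class with a finite multiplicative net: with high probability every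
maximizer is close to a member of the net whose Hellinger affinity to the truth is large. -/
theorem one_sub_le_measureReal_mle {pY : Fin K → ℝ} (hY : ∀ y, 0 ≤ pY y) (hY1 : ∑ y, pY y = 1)
    (hn : 0 < n) {P : Set (CondPmf K D M)} {p : CondPmf K D M} (hpP : p ∈ P)
    (hpos : ∀ q ∈ P, ∀ y x, 0 < q y x) (hsum : ∀ q ∈ P, ∀ y, ∑ x, q y x = 1)
    (N : Finset (CondPmf K D M)) (hN : ∀ q ∈ N, q ∈ P)
    (hnet : ∀ r ∈ P, ∃ q ∈ N, ∀ y x, r y x ≤ Real.exp (1 / n) * q y x)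
    {δ E ε : ℝ} (hδ : 0 < δ) (hE : (N.card : ℝ) ≤ Real.exp E)
    (hε : 2 / n + √((2 * E + 2 * Real.log (1 / δ) + 1) / n) ≤ ε) :
    1 - δ ≤ (Measure.pi fun _ : Fin n => jointLaw p pY).real
      {s | ∀ r, IsCondMLE P s r → avgTV pY r p ≤ ε} := by
  have hn' : (1 : ℝ) ≤ n := by exact_mod_cast hn
  set Q : (Fin D → Fin M) × Fin K → ℝ := fun z => p z.2 z.1 * pY z.2 with hQ
  have hQ0 : ∀ z, 0 ≤ Q z := fun z => mul_nonneg (hpos p hpP _ _).le (hY _)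
  have hQ1 : ∑ z, Q z = 1 := by
    rw [Fintype.sum_prod_type_right]
    simp only [hQ, ← Finset.sum_mul, hsum p hpP, one_mul, hY1]
  -- The square root of the likelihood ratio is used because its mean under `p` is the Hellinger
  -- affinity (`hρ`).
  set g : CondPmf K D M → (Fin D → Fin M) × Fin K → ℝ :=
    fun q z => √(q z.2 z.1 / p z.2 z.1) with hg
  have hρ : ∀ q, ∑ z, Q z * g q z = ∑ y, pY y * ∑ x, √(q y x * p y x) := fun q => by
    rw [Fintype.sum_prod_type_right]
    refine Finset.sum_congr rfl fun y _ => ?_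
    rw [Finset.mul_sum]
    refine Finset.sum_congr rfl fun x _ => ?_
    have h0 := hpos p hpP y x
    have : q y x * p y x = p y x ^ 2 * (q y x / p y x) := by field_simp
    simp only [hQ, hg, this]
    rw [Real.sqrt_mul (sq_nonneg _), Real.sqrt_sq h0.le]
    ring
  have hρ0 : ∀ q ∈ N, 0 < ∑ z, Q z * g q z := fun q hq => by
    obtain ⟨z, -, hz⟩ : ∃ z ∈ Finset.univ, Q z ≠ 0 := Finset.exists_ne_zero_of_sum_ne_zero
      (by rw [hQ1]; exact one_ne_zero)
    refine Finset.sum_pos' (fun z _ => mul_nonneg (hQ0 z) (Real.sqrt_nonneg _))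
      ⟨z, Finset.mem_univ _, mul_pos ((hQ0 z).lt_of_ne' hz) (Real.sqrt_pos.2 ?_)⟩
    exact div_pos (hpos q (hN q hq) _ _) (hpos p hpP _ _)
  -- With this threshold the union bound `N.card / c` is at most `δ`.
  have hc : 0 < Real.exp E / δ := div_pos (Real.exp_pos _) hδ
  have hbad := measureReal_exists_prod_ge_le hQ0 hQ1 n N g (fun _ _ => Real.sqrt_nonneg _) hc hρ0
  have hlaw : jointLaw p pY = ∑ z, ENNReal.ofReal (Q z) • Measure.dirac z := rfl
  have := isProbabilityMeasure_finite_law hQ0 hQ1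
  rw [hlaw]
  set μ := Measure.pi fun _ : Fin n => ∑ z, ENNReal.ofReal (Q z) • Measure.dirac z with hμ
  set bad := {s : Fin n → (Fin D → Fin M) × Fin K |
    ∃ q ∈ N, Real.exp E / δ * (∑ z, Q z * g q z) ^ n ≤ ∏ i, g q (s i)} with hbadset
  have hbad' : μ.real bad ≤ δ := hbad.trans (by
    rw [div_div_eq_mul_div, div_le_iff₀ (Real.exp_pos _), mul_comm]
    exact mul_le_mul_of_nonneg_left hE hδ.le)
  have hcompl : 1 - δ ≤ μ.real badᶜ := by
    rw [probReal_compl_eq_one_sub (Set.toFinite bad).measurableSet]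
    linarith
  refine hcompl.trans (measureReal_mono fun s hs r hr => ?_)
  obtain ⟨q, hqN, hq⟩ := hnet r hr.1
  have hqP := hN q hqN
  have hs' : ∏ i, g q (s i) < Real.exp E / δ * (∑ z, Q z * g q z) ^ n := by
    by_contra hcon
    exact hs ⟨q, hqN, not_lt.1 hcon⟩
  rw [hρ] at hs'
  set ρ := ∑ y, pY y * ∑ x, √(q y x * p y x) with hρdef
  have hρpos : 0 < ρ := by rw [hρdef, ← hρ]; exact hρ0 q hqN
  -- the likelihood ratio of the net member is bounded below
  have hlik : Real.exp (-1) ≤ (∏ i, g q (s i)) ^ 2 := by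
    have hL0 : 0 < likelihood s p := Finset.prod_pos fun i _ => hpos p hpP _ _
    have h1 : likelihood s p ≤ Real.exp 1 * likelihood s q := by
      refine (hr.2 p hpP).trans ((Finset.prod_le_prod (fun i _ => (hpos r hr.1 _ _).le)
        fun i _ => hq (s i).2 (s i).1).trans (le_of_eq ?_))
      rw [Finset.prod_mul_distrib, Finset.prod_const, Finset.card_univ, Fintype.card_fin,
        ← Real.exp_nat_mul, mul_one_div_cancel (by linarith)]
      rfl
    have h2 : (∏ i, g q (s i)) ^ 2 = likelihood s q / likelihood s p := by
      rw [← Finset.prod_pow]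
      simp only [likelihood, ← Finset.prod_div_distrib, hg]
      exact Finset.prod_congr rfl fun i _ =>
        Real.sq_sqrt (div_pos (hpos q hqP _ _) (hpos p hpP _ _)).le
    rw [h2, le_div_iff₀ hL0, Real.exp_neg, inv_mul_le_iff₀ (Real.exp_pos _)]
    exact h1
  have haff : n * (2 - 2 * ρ) ≤ 2 * E + 2 * Real.log (1 / δ) + 1 := by
    have h1 : ρ ≤ Real.exp (ρ - 1) := by linarith [Real.add_one_le_exp (ρ - 1)]
    have h2 : Real.exp E / δ * ρ ^ n ≤ Real.exp (E + Real.log (1 / δ) + n * (ρ - 1)) := by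
      rw [Real.exp_add, Real.exp_add, Real.exp_log (by positivity), Real.exp_nat_mul,
        ← div_eq_mul_one_div]
      gcongr
    -- The squared product is at least `exp (-1)` by maximality and at most a squared exponential
    -- off the bad event; comparing exponents gives the claim.
    have h3 := hlik.trans (pow_le_pow_left₀ (Finset.prod_nonneg fun i _ => Real.sqrt_nonneg _)
      (hs'.le.trans h2) 2)
    rw [← Real.exp_nat_mul, Real.exp_le_exp] at h3
    push_cast at h3
    linarith
  have hTV1 : avgTV pY r q ≤ 2 / n := by
    have he1 : 1 ≤ Real.exp (1 / n) := Real.one_le_exp (by positivity)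
    refine (avgTV_le_of_le_mul hY hY1 he1 (fun y x => (hpos q hqP y x).le) (hsum r hr.1)
      (hsum q hqP) hq).trans ?_
    have h0 : 0 ≤ 1 / (n : ℝ) := by positivity
    have := Real.abs_exp_sub_one_le (x := 1 / (n : ℝ))
      (by rw [abs_of_nonneg h0, div_le_one (by linarith)]; exact hn')
    rw [abs_of_nonneg h0] at this
    calc Real.exp (1 / n) - 1 ≤ 2 * (1 / n) := (le_abs_self _).trans this
      _ = 2 / n := by ring
  have hTV2 : avgTV pY q p ≤ √((2 * E + 2 * Real.log (1 / δ) + 1) / n) := by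
    refine Real.le_sqrt_of_sq_le ((avgTV_sq_le_hellinger hY hY1 (fun y x => (hpos q hqP y x).le)
      (fun y x => (hpos p hpP y x).le) (hsum q hqP) (hsum p hpP)).trans ?_)
    rw [le_div_iff₀ (by linarith), mul_comm]
    exact haff
  exact (avgTV_triangle hY r q p).trans ((add_le_add hTV1 hTV2).trans hε)

end Estimation

end CondARM

/-! ### The rate for the single-source estimator. -/

theorem theorem6 :
    ∃ C : ℝ, 0 < C ∧
      ∀ (K D M de L W S n : ℕ) (B δ : ℝ)
        (pY : Fin K → ℝ)
        (φstar : Fin K → Fin de → ℝ) (ψstar : CondARM.SharedParam D M de L),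
        0 < D → 0 < M → 0 < de → 0 < L → 0 < W → 0 < S → 0 < B → 0 < n →
        0 < δ → δ ≤ 1 / 2 →
        (∀ y, 0 ≤ pY y) → ∑ y, pY y = 1 →
        (∀ k, φstar k ∈ CondARM.PhiSpace de) →
        ψstar ∈ CondARM.PsiSpace D M de L W S B →
        1 - δ ≤
          (MeasureTheory.Measure.pi fun _ : Fin n =>
            CondARM.jointLaw (fun y x => CondARM.armPmf (φstar y) ψstar x) pY).real
          {s | ∀ phat : CondARM.CondPmf K D M,
            CondARM.IsCondMLE (CondARM.singleClass K D M de L W S B) s phat →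
            CondARM.avgTV pY phat (fun y x => CondARM.armPmf (φstar y) ψstar x) ≤
              C * Real.sqrt
                (((K : ℝ) * L * (S + D + (D + M + 1) * de)
                    * Real.log ((n : ℝ) * D * de * L * max B 1 * (W + 1))
                  + Real.log (1 / δ)) / n)} := by
  -- `10 = 4 + 6`: the distance from the maximizer to the net (`h1`) plus the deviation term (`h2`).
  refine ⟨10, by norm_num, ?_⟩
  intro K D M de L W S n B δ pY φstar ψstar hD hM hde hL hW hS hB hn hδ hδ2 hY hY1 hφ hψ
  have : NeZero M := ⟨hM.ne'⟩
  obtain ⟨N, hcard, hmem, hnet⟩ :=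
    CondARM.exists_net_at_rate (M := M) hD hde hL hW hS hB hn
  have hn' : (1 : ℝ) ≤ n := by exact_mod_cast hn
  set Λ : ℝ := (n : ℝ) * D * de * L * max B 1 * (W + 1) with hΛ
  have hΛ1 : 1 ≤ Λ := by
    have h1 : (1 : ℝ) ≤ D := by exact_mod_cast hD
    have h2 : (1 : ℝ) ≤ de := by exact_mod_cast hde
    have h3 : (1 : ℝ) ≤ L := by exact_mod_cast hL
    have h4 : (1 : ℝ) ≤ W + 1 := by linarith [Nat.cast_nonneg (α := ℝ) W]
    exact one_le_mul_of_one_le_of_one_le (one_le_mul_of_one_le_of_one_le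
      (one_le_mul_of_one_le_of_one_le (one_le_mul_of_one_le_of_one_le
        (one_le_mul_of_one_le_of_one_le hn' h1) h2) h3) (le_max_right _ _)) h4
  set R : ℝ := (K : ℝ) * L * (S + D + (D + M + 1) * de) * Real.log Λ with hR
  have hR0 : 0 ≤ R := mul_nonneg (by positivity) (Real.log_nonneg hΛ1)
  -- This is where `δ ≤ 1 / 2` enters: it keeps `A` away from zero, so that `2 / n` and the additive
  -- 1 are absorbed.
  have hlogδ : 1 / 2 ≤ Real.log (1 / δ) := by
    have h1 : Real.log 2 ≤ Real.log (1 / δ) := Real.log_le_log (by norm_num) (by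
      rw [le_div_iff₀ hδ]
      linarith)
    linarith [Real.log_two_gt_d9]
  set A := R + Real.log (1 / δ) with hA
  have hA1 : 1 / 2 ≤ A := by linarith
  have h1 : 2 / (n : ℝ) ≤ 4 * √(A / n) := by
    have : 1 / (n : ℝ) ≤ √(4 * (A / n)) := Real.le_sqrt_of_sq_le (by
      rw [one_div, sq]
      calc (n : ℝ)⁻¹ * (n : ℝ)⁻¹ ≤ 1 * (n : ℝ)⁻¹ := by
            gcongr
            exact inv_le_one_of_one_le₀ hn'
        _ ≤ 4 * A * (n : ℝ)⁻¹ := by gcongr; linarith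
        _ = 4 * (A / n) := by ring)
    rw [Real.sqrt_mul (by norm_num), show (4 : ℝ) = 2 ^ 2 by norm_num,
      Real.sqrt_sq (by norm_num)] at this
    calc 2 / (n : ℝ) = 2 * (1 / n) := by ring
      _ ≤ 2 * (2 * √(A / n)) := by gcongr
      _ = _ := by ring
  have h2 : √((2 * (17 * R) + 2 * Real.log (1 / δ) + 1) / n) ≤ 6 * √(A / n) := by
    rw [show (6 : ℝ) * √(A / n) = √(6 ^ 2 * (A / n)) by
      rw [Real.sqrt_mul (by norm_num), Real.sqrt_sq (by norm_num)]]
    refine Real.sqrt_le_sqrt ?_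
    rw [← mul_div_assoc]
    gcongr
    linarith
  exact CondARM.one_sub_le_measureReal_mle (E := 17 * R) hY hY1 hn
    (P := CondARM.singleClass K D M de L W S B)
    (p := fun y x => CondARM.armPmf (φstar y) ψstar x) ⟨φstar, fun _ => ψstar, hφ, fun _ => hψ, rfl⟩
    (by rintro _ ⟨φ, ψ, -, -, rfl⟩ y x; exact CondARM.armPmf_pos _ _ _)
    (by rintro _ ⟨φ, ψ, -, -, rfl⟩ y; exact CondARM.sum_armPmf _ _)
    -- A net point is chosen for each source independently, so the cardinality is `N.card ^ K`.
    (Fintype.piFinset fun _ => N)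
    (by
      intro q hq
      choose φ h1 ψ h2 h3 using fun y => hmem (q y) (Fintype.mem_piFinset.1 hq y)
      exact ⟨φ, ψ, h1, h2, funext fun y => h3 y⟩)
    (by
      rintro _ ⟨φ, ψ, h1, h2, rfl⟩
      choose q hq h using fun y => hnet (φ y) (h1 y) (ψ y) (h2 y)
      exact ⟨q, Fintype.mem_piFinset.2 hq, h⟩)
    hδ
    (by
      have e : Real.exp (17 * R) = (Λ ^ (17 * (L * (S + (D + (D + M + 1) * de))))) ^ K := by
        rw [← pow_mul, ← Real.exp_log (pow_pos (zero_lt_one.trans_le hΛ1) _), Real.log_pow, hR]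
        push_cast
        ring_nf
      rw [e, Fintype.card_piFinset]
      simp only [Finset.prod_const, Finset.card_univ, Fintype.card_fin]
      push_cast
      gcongr)
    (by linarith)
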